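/- Let $n\ge 1$ and let $p:\mathbb R^n\to[1,\infty)$ be a measurable exponent with $1<p^-:=\operatorname{ess\,inf}p$ and $p^+:=\operatorname{ess\,sup}p<\infty$, such that $1/p$ is log-H\"older continuous: there is $L>0$ with $|1/p(x)-1/p(y)|\le L/\log(e+1/|x-y|)$ for all $x\neq y$ (this covers all bounded Lipschitz exponents). Let $\mathcal A:\mathbb R^n\times\mathbb R\times\mathbb R^n\to\mathbb R^n$ be a Carath\'eodory function (measurable in $x$ for each $(t,\xi)$, continuous in $(t,\xi)$ for each $x$) of $p(\cdot)$-growth: there are measurable functions $a\le b$ on $\mathbb R^n$ with $\inf a>0$ and $\sup b<\infty$ such that for all $(x,t,\xi)$ $$\langle \mathcal A(x,t,\xi),\xi\rangle\ge a(x)|\xi|^{p(x)},\qquad |\mathcal A(x,t,\xi)|\le b(x)|\xi|^{p(x)-1}.$$ Assume $p^->n$. Let $f:[0,\infty)\to\mathbb R$ be continuous and let $u\in W^{1,p(\cdot)}_{loc}(\mathbb R^n)$ be (essentially) bounded. Suppose that there are a measurable exponent $q:\mathbb R^n\to[1,\infty)$ and bounded measurable functions $c,d:\mathbb R^n\to\mathbb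 R$ with $0<\inf c\le\sup c<\inf d\le \sup d<\infty$ such that $$c(x)|\nabla u(x)|^{q(x)}\le f(|\nabla u(x)|)\le d(x)\bigl(1+|\nabla u(x)|^{p(x)-1}\bigr)\qquad\text{for a.e. }x\in\mathbb R^n.$$ If $u$ satisfies the Riccati-type inequality $\operatorname{div}\mathcal A(x,u,\nabla u)\ge f(|\nabla u|)$ weakly on $\mathbb R^n$, i.e. $$-\int_{\mathbb R^n}\langle \mathcal A(x,u,\nabla u),\nabla\phi\rangle\,dx\ \ge\ \int_{\mathbb R^n} f(|\nabla u|)\,\phi\,dx\qquad\text{for all }0\le\phi\in C_0^\infty(\mathbb R^n),$$ then $u$ is constant (almost everywhere). -/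

import Mathlib

open MeasureTheory
open scoped NNReal ENNReal ContDiff

/-- Euclidean space `ℝⁿ`. -/
abbrev Rn (n : ℕ) : Type := EuclideanSpace ℝ (Fin n)

/-- Log-Hölder continuity on `ℝⁿ`: `|α(x) - α(y)| ≤ L / log (e + 1 / |x - y|)` for some `L > 0`. -/
def IsLogHolder {n : ℕ} (α : Rn n → ℝ) : Prop :=
  ∃ L : ℝ, 0 < L ∧ ∀ x y : Rn n, |α x - α y| ≤ L / Real.log (Real.exp 1 + 1 / dist x y)

/-- `p⁻`, the essential infimum of the exponent over `ℝⁿ`. -/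
noncomputable def exponentInf {n : ℕ} (p : Rn n → ℝ) : ℝ :=
  essInf p volume

/-- A finite-valued variable exponent: a measurable function with values in `[1, ∞)`. -/
structure IsVariableExponent {n : ℕ} (p : Rn n → ℝ) : Prop where
  measurable : Measurable p
  one_le : ∀ x, 1 ≤ p x

/-- The class of exponents in which the Sobolev spaces are considered: variable exponents with
`1 < p⁻` and `p⁺ < ∞` for which `1 / p` is log-Hölder continuous. -/
structure IsLogHolderExponent {n : ℕ} (p : Rn n → ℝ) : Prop extends IsVariableExponent p where
  essBounded : ∃ P : ℝ, ∀ᵐ x, p x ≤ P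
  one_lt_inf : 1 < exponentInf p
  logHolder : IsLogHolder (fun x => 1 / p x)

/-- The modular `∫_S |v(x)|^{p(x)} dx`, with values in `[0, ∞]`. -/
noncomputable def modular {n : ℕ} {F : Type*} [NormedAddCommGroup F] (p : Rn n → ℝ)
    (S : Set (Rn n)) (v : Rn n → F) : ℝ≥0∞ :=
  ∫⁻ x in S, ENNReal.ofReal (‖v x‖ ^ p x)

/-- `v ∈ L^{p(·)}(S)`: `v` is measurable and the modular of `v / μ` is finite for some `μ > 0`. -/
def MemVarLp {n : ℕ} {F : Type*} [NormedAddCommGroup F] [NormedSpace ℝ F] (p : Rn n → ℝ)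
    (S : Set (Rn n)) (v : Rn n → F) : Prop :=
  AEStronglyMeasurable v (volume.restrict S) ∧
    ∃ μ : ℝ, 0 < μ ∧ modular p S (fun x => μ⁻¹ • v x) < ⊤

/-- `v ∈ L^{p(·)}_loc(ℝⁿ)`. -/
def MemVarLpLoc {n : ℕ} {F : Type*} [NormedAddCommGroup F] [NormedSpace ℝ F] (p : Rn n → ℝ)
    (v : Rn n → F) : Prop :=
  ∀ K : Set (Rn n), IsCompact K → MemVarLp p K v

/-- Test functions: `φ ∈ C₀^∞(ℝⁿ)`. -/
def IsTestFunction {n : ℕ} (φ : Rn n → ℝ) : Prop :=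
  ContDiff ℝ ∞ φ ∧ HasCompactSupport φ

/-- `g` is the distributional gradient of `u` on `ℝⁿ`. -/
def IsWeakGradient {n : ℕ} (u : Rn n → ℝ) (g : Rn n → Rn n) : Prop :=
  LocallyIntegrable u ∧ LocallyIntegrable g ∧
    ∀ φ : Rn n → ℝ, IsTestFunction φ → ∀ v : Rn n,
      ∫ x, u x * inner ℝ (gradient φ x) v = -∫ x, φ x * inner ℝ (g x) v

/-- `u ∈ W^{1,p(·)}_loc(ℝⁿ)` with distributional gradient `∇u = g`. -/
structure IsSobolevLoc {n : ℕ} (p : Rn n → ℝ) (u : Rn n → ℝ) (g : Rn n → Rn n) : Prop where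
  weakGradient : IsWeakGradient u g
  memVarLpLoc : MemVarLpLoc p u
  gradient_memVarLpLoc : MemVarLpLoc p g

/-- Carathéodory functions: measurable in `x`, continuous in `(t, ξ)`. -/
structure IsCaratheodory {n : ℕ} (A : Rn n → ℝ → Rn n → Rn n) : Prop where
  measurable : ∀ t ξ, Measurable fun x => A x t ξ
  continuous : ∀ x, Continuous fun z : ℝ × Rn n => A x z.1 z.2

/-- `A` is a Carathéodory function of `p(·)`-growth. -/
structure HasVarGrowth {n : ℕ} (p : Rn n → ℝ) (A : Rn n → ℝ → Rn n → Rn n) : Prop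
    extends IsCaratheodory A where
  growth : ∃ (a b : Rn n → ℝ) (aMin bMax : ℝ), Measurable a ∧ Measurable b ∧ 0 < aMin ∧
    (∀ x, aMin ≤ a x) ∧ (∀ x, a x ≤ b x) ∧ (∀ x, b x ≤ bMax) ∧
    (∀ x t ξ, a x * ‖ξ‖ ^ p x ≤ inner ℝ (A x t ξ) ξ) ∧
    (∀ x t ξ, ‖A x t ξ‖ ≤ b x * ‖ξ‖ ^ (p x - 1))

/-- The two-sided bound `c(x)|∇u|^{q(x)} ≤ f(|∇u|) ≤ d(x)(1 + |∇u|^{p(x)-1})` for almost every `x`,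
where `g = ∇u` and `c`, `d` are measurable with `0 < c₋ ≤ c ≤ c⁺ < d₋ ≤ d ≤ d₊`. -/
def RiccatiBounds {n : ℕ} (p q : Rn n → ℝ) (c d : Rn n → ℝ) (f : ℝ≥0 → ℝ)
    (g : Rn n → Rn n) : Prop :=
  Measurable c ∧ Measurable d ∧
  (∃ cMin cMax dMin dMax : ℝ, 0 < cMin ∧ cMax < dMin ∧
    ∀ x, cMin ≤ c x ∧ c x ≤ cMax ∧ dMin ≤ d x ∧ d x ≤ dMax) ∧
  ∀ᵐ x, c x * ‖g x‖ ^ q x ≤ f ‖g x‖₊ ∧ f ‖g x‖₊ ≤ d x * (1 + ‖g x‖ ^ (p x - 1))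

/-- `div A(x, u, ∇u) ≥ f(|∇u|)` weakly on `ℝⁿ`, where `g = ∇u`. -/
def IsWeakRiccatiSupersolution {n : ℕ} (A : Rn n → ℝ → Rn n → Rn n) (f : ℝ≥0 → ℝ)
    (u : Rn n → ℝ) (g : Rn n → Rn n) : Prop :=
  ∀ φ : Rn n → ℝ, IsTestFunction φ → (∀ x, 0 ≤ φ x) →
    ∫ x, f ‖g x‖₊ * φ x ≤ -∫ x, inner ℝ (A x (u x) (g x)) (gradient φ x)

open Filter Topology Metric ContinuousLinearMap
open scoped Convolution

/-! ### Log-Hölder exponents -/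

/-! Since `c > 0`, the lower bound `c|∇u|^q ≤ f(|∇u|)` forces `f(|∇u|) ≥ 0`, so `u` is a bounded
weak solution of `div A(x,u,∇u) ≥ 0`. Testing with `η^(l+1) (u + M)`, where `|u| ≤ M` and `η` cuts
off between the balls of radii `R` and `2R`, gives a Caccioppoli estimate: for large `R`, `∫_{B_R}
|∇u|^p ≤ 2 (E/R)^{p⁻} |B_{2R}|`, which is of order `R^{n - p⁻}`. As `p⁻ > n`, letting `R → ∞` gives
`∇u = 0`, so `u` is constant. The two halves are `exists_setIntegral_norm_rpow_le` and
`ae_gradient_eq_zero`.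

The delicate point is that `η^(l+1) (u + M)` is not smooth. It is replaced by `ζ (ρ_k ⋆ u + M)`,
still nonnegative, and the limit must be taken in `∫ ζ ⟨ρ_k ⋆ ∇u, A⟩`. Log-Hölder continuity enters
here: it yields `|ρ_k ⋆ ∇u|^{p(x)} ≤ C (1 + ρ_k ⋆ (1_S |∇u|^p))` uniformly in `k`
(`exists_norm_mollify_rpow_le`). These majorants converge almost everywhere and keep the same
integral, so a Fatou argument suffices (`integral_inner_mul_le`). -/

theorem one_le_log_exp_one_add {t : ℝ} (ht : 0 ≤ t) : 1 ≤ Real.log (Real.exp 1 + t) := by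
  calc (1 : ℝ) = Real.log (Real.exp 1) := (Real.log_exp 1).symm
    _ ≤ _ := Real.log_le_log (Real.exp_pos 1) (by linarith)

/-- The modulus in `IsLogHolder` is monotone in the distance. -/
theorem abs_sub_le_of_logHolder {n : ℕ} {α : Rn n → ℝ} {L : ℝ} (hL : 0 < L)
    (h : ∀ x y : Rn n, |α x - α y| ≤ L / Real.log (Real.exp 1 + 1 / dist x y))
    {x y : Rn n} {ε : ℝ} (hε : 0 < ε) (hxy : dist x y ≤ ε) :
    |α x - α y| ≤ L / Real.log (Real.exp 1 + 1 / ε) := by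
  have hlog : 1 ≤ Real.log (Real.exp 1 + 1 / ε) := one_le_log_exp_one_add (by positivity)
  rcases eq_or_ne x y with rfl | hne
  · simp only [sub_self, abs_zero]
    positivity
  · have hd : 0 < dist x y := dist_pos.2 hne
    refine (h x y).trans (div_le_div_of_nonneg_left hL.le (by linarith) ?_)
    refine Real.log_le_log (by positivity) ?_
    gcongr

theorem IsLogHolder.continuous {n : ℕ} {α : Rn n → ℝ} (h : IsLogHolder α) : Continuous α := by
  obtain ⟨L, hL, h⟩ := h
  refine Metric.continuous_iff.2 fun x η hη => ?_
  -- This radius makes the logarithm in the modulus at least `L/η + 1`, so the modulus is strictly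
  -- below `η`.
  refine ⟨Real.exp (-(L / η + 1)), Real.exp_pos _, fun y hy => ?_⟩
  rw [Real.dist_eq]
  refine (abs_sub_le_of_logHolder hL h (Real.exp_pos _) hy.le).trans_lt ?_
  have h1 : L / η + 1 ≤ Real.log (Real.exp 1 + 1 / Real.exp (-(L / η + 1))) := by
    rw [Real.exp_neg, one_div, inv_inv]
    calc L / η + 1 = Real.log (Real.exp (L / η + 1)) := (Real.log_exp _).symm
      _ ≤ _ := Real.log_le_log (Real.exp_pos _) (by linarith [Real.exp_pos 1])
  have h2 : 0 < L / η := by positivity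
  rw [div_lt_iff₀ (by linarith)]
  calc L = η * (L / η) := by field_simp
    _ < _ := by gcongr; linarith

theorem IsLogHolderExponent.continuous {n : ℕ} {p : Rn n → ℝ} (hp : IsLogHolderExponent p) :
    Continuous p := by
  have h := hp.logHolder.continuous
  have h2 : Continuous fun x => (1 / p x)⁻¹ :=
    h.inv₀ fun x => (one_div_pos.2 (zero_lt_one.trans_le (hp.one_le x))).ne'
  simpa using h2

/-- A set of full Lebesgue measure is dense. This turns the essential bounds on the continuous
exponent into pointwise ones. -/
theorem Continuous.forall_le_of_ae_le {n : ℕ} {f g : Rn n → ℝ} (hf : Continuous f)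
    (hg : Continuous g) (h : ∀ᵐ x, f x ≤ g x) : ∀ x, f x ≤ g x := by
  have hd := Measure.dense_of_ae h
  have hc : IsClosed {x | f x ≤ g x} := isClosed_le hf hg
  intro x
  have : x ∈ closure {x | f x ≤ g x} := hd x
  rwa [hc.closure_eq] at this

theorem IsLogHolderExponent.exists_upper_bound {n : ℕ} {p : Rn n → ℝ}
    (hp : IsLogHolderExponent p) : ∃ P : ℝ, ∀ x, p x ≤ P :=
  let ⟨P, hP⟩ := hp.essBounded
  ⟨P, hp.continuous.forall_le_of_ae_le continuous_const hP⟩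

theorem IsLogHolderExponent.exponentInf_le {n : ℕ} {p : Rn n → ℝ}
    (hp : IsLogHolderExponent p) (x : Rn n) : exponentInf p ≤ p x := by
  refine Continuous.forall_le_of_ae_le continuous_const hp.continuous ?_ x
  exact ae_essInf_le (isBoundedUnder_of ⟨1, hp.one_le⟩)

/-! ### A Jensen-type inequality for variable exponents -/

/-- Either `F ≤ τ`, or `F/τ ≥ 1` and raising it to a power `r ≥ 1` only increases it. The free scale
`τ` is what replaces convexity when the exponent varies. -/
theorem le_add_mul_div_rpow {F τ r : ℝ} (hF : 0 ≤ F) (hτ : 0 < τ) (hr : 1 ≤ r) :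
    F ≤ τ + τ * (F / τ) ^ r := by
  rcases le_total F τ with h | h
  · have : 0 ≤ τ * (F / τ) ^ r := by positivity
    linarith
  · have h1 : 1 ≤ F / τ := (one_le_div hτ).2 h
    have h2 : F / τ ≤ (F / τ) ^ r := by
      simpa using Real.rpow_le_rpow_of_exponent_le h1 hr
    calc F = τ * (F / τ) := by field_simp
      _ ≤ τ * (F / τ) ^ r := by gcongr
      _ ≤ _ := by linarith

/-- Apply the preceding bound at the scale `τ = T^(1/r)`, with `T = 1 + ∫ w F^s`. Then `(F/τ)^s =
T^(-s/r) F^s ≤ (C/T) F^s` by `hT`, so averaging gives `∫ w F ≤ (1 + C) τ`, and `τ^r = T`. Thus `hT`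
measures what the oscillation of `s` around `r` costs. -/
theorem integral_rpow_le_of_rpow_le {X : Type*} [MeasurableSpace X] {μ : Measure X}
    {w F s : X → ℝ} {r C : ℝ} (hw : ∀ t, 0 ≤ w t) (hw1 : ∫ t, w t ∂μ = 1) (hF : ∀ t, 0 ≤ F t)
    (hs : ∀ t, 1 ≤ s t) (hr : 1 ≤ r) (hC : 0 ≤ C) (hwi : Integrable w μ)
    (hFi : Integrable (fun t => w t * F t) μ) (hHi : Integrable (fun t => w t * F t ^ s t) μ)
    (hT : ∀ t, w t ≠ 0 → (1 + ∫ t, w t * F t ^ s t ∂μ) ^ (1 - s t / r) ≤ C) :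
    (∫ t, w t * F t ∂μ) ^ r ≤ (1 + C) ^ r * (1 + ∫ t, w t * F t ^ s t ∂μ) := by
  have hI : 0 ≤ ∫ t, w t * F t ^ s t ∂μ :=
    integral_nonneg fun t => mul_nonneg (hw t) (Real.rpow_nonneg (hF t) _)
  set I := ∫ t, w t * F t ^ s t ∂μ with hIdef
  have hTpos : 0 < 1 + I := by linarith
  set T := 1 + I with hTdef
  set τ := T ^ (1 / r) with hτdef
  have hτ : 0 < τ := Real.rpow_pos_of_pos hTpos _
  have hpt : ∀ t, w t * F t ≤ τ * w t + τ * C / T * (w t * F t ^ s t) := by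
    intro t
    rcases eq_or_ne (w t) 0 with h0 | h0
    · simp [h0]
    · have h1 := le_add_mul_div_rpow (hF t) hτ (hs t)
      have h2 : (F t / τ) ^ s t ≤ C / T * F t ^ s t := by
        have h3 : τ ^ s t = T ^ (s t / r) := by
          rw [hτdef, ← Real.rpow_mul hTpos.le]; congr 1; ring
        have h4 : T ^ (1 - s t / r) = T / T ^ (s t / r) := by
          rw [Real.rpow_sub hTpos, Real.rpow_one]
        have h5 := hT t h0
        have h6 : 0 < T ^ (s t / r) := Real.rpow_pos_of_pos hTpos _
        rw [Real.div_rpow (hF t) hτ.le, h3]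
        rw [h4, div_le_iff₀ h6] at h5
        have h7 : (T ^ (s t / r))⁻¹ ≤ C / T := by
          rw [inv_le_iff_one_le_mul₀ h6, div_mul_eq_mul_div, one_le_div hTpos]
          exact h5
        rw [div_eq_mul_inv, mul_comm]
        exact mul_le_mul_of_nonneg_right h7 (Real.rpow_nonneg (hF t) _)
      calc w t * F t ≤ w t * (τ + τ * (C / T * F t ^ s t)) := by
            refine mul_le_mul_of_nonneg_left (h1.trans ?_) (hw t)
            gcongr
        _ = _ := by ring
  have hint : ∫ t, w t * F t ∂μ ≤ (1 + C) * τ := by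
    calc ∫ t, w t * F t ∂μ ≤ ∫ t, (τ * w t + τ * C / T * (w t * F t ^ s t)) ∂μ :=
          integral_mono hFi ((hwi.const_mul _).add (hHi.const_mul _)) hpt
      _ = τ + τ * C / T * I := by
          rw [integral_add (hwi.const_mul _) (hHi.const_mul _), integral_const_mul,
            integral_const_mul, hw1, mul_one]
      _ ≤ τ + τ * C / T * T := by
          have : 0 ≤ τ * C / T := by positivity
          gcongr; linarith
      _ = (1 + C) * τ := by field_simp
  calc (∫ t, w t * F t ∂μ) ^ r ≤ ((1 + C) * τ) ^ r :=
        Real.rpow_le_rpow (integral_nonneg fun t => mul_nonneg (hw t) (hF t)) hint (by linarith)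
    _ = (1 + C) ^ r * T := by
        rw [Real.mul_rpow (by linarith) hτ.le, hτdef, ← Real.rpow_mul hTpos.le,
          one_div_mul_cancel (by linarith), Real.rpow_one]

/-- With `l = log(e + 1/ε)`, polynomial growth of `T` in `1/ε` means `log T ≤ (log B + n) l`, and
the factor `l` cancels against `θ ≤ Q/l`. This cancellation is why the log-Hölder modulus is the
right one. -/
theorem rpow_le_exp_of_le_div_log {T B ε Q θ : ℝ} {n : ℕ} (hT : 1 ≤ T) (hε : 0 < ε)
    (hB : 1 ≤ B) (hTB : T ≤ B * (1 / ε) ^ n) (hQ : 0 ≤ Q)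
    (hθ : θ ≤ Q / Real.log (Real.exp 1 + 1 / ε)) :
    T ^ θ ≤ Real.exp (Q * (Real.log B + n)) := by
  have hl : 1 ≤ Real.log (Real.exp 1 + 1 / ε) := one_le_log_exp_one_add (by positivity)
  set l := Real.log (Real.exp 1 + 1 / ε) with hldef
  have hT0 : 0 < T := by linarith
  have h1 : Real.log T ≤ (Real.log B + n) * l := by
    have h2 : Real.log (1 / ε) ≤ l :=
      Real.log_le_log (by positivity) (by linarith [Real.exp_pos 1])
    have h3 : 0 ≤ Real.log B := Real.log_nonneg hB
    calc Real.log T ≤ Real.log (B * (1 / ε) ^ n) := Real.log_le_log hT0 hTB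
      _ = Real.log B + n * Real.log (1 / ε) := by
          rw [Real.log_mul (by positivity) (by positivity), Real.log_pow]
      _ ≤ Real.log B * l + n * l := by
          gcongr
          exact le_mul_of_one_le_right h3 hl
      _ = _ := by ring
  rw [Real.rpow_def_of_pos hT0]
  refine Real.exp_le_exp.2 ?_
  calc Real.log T * θ ≤ Real.log T * (Q / l) :=
        mul_le_mul_of_nonneg_left hθ (Real.log_nonneg hT)
    _ ≤ (Real.log B + n) * l * (Q / l) := by gcongr
    _ = _ := by field_simp

/-! ### Mollification -/

/-- A sequence of smooth bumps at the origin, supported in the balls of radius `1 / (k + 1)`. -/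
noncomputable def mollifierBump (n k : ℕ) : ContDiffBump (0 : Rn n) where
  rIn := 1 / (2 * ((k : ℝ) + 1))
  rOut := 1 / ((k : ℝ) + 1)
  rIn_pos := by positivity
  rIn_lt_rOut := by
    have : (0 : ℝ) < (k : ℝ) + 1 := by positivity
    exact one_div_lt_one_div_of_lt this (by linarith)

/-- The normalised mollifiers. -/
noncomputable def mollifier (n k : ℕ) : Rn n → ℝ := (mollifierBump n k).normed volume

/-- The mollification `ρ_k ⋆ v`. -/
noncomputable def mollify {n : ℕ} {F : Type*} [NormedAddCommGroup F] [NormedSpace ℝ F]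
    (k : ℕ) (v : Rn n → F) : Rn n → F :=
  (mollifier n k ⋆[lsmul ℝ ℝ, volume] v)

section
variable {n : ℕ} {F : Type*} [NormedAddCommGroup F] [NormedSpace ℝ F]

theorem mollify_apply (k : ℕ) (v : Rn n → F) (x : Rn n) :
    mollify k v x = ∫ t, mollifier n k t • v (x - t) := rfl

theorem mollifier_nonneg (k : ℕ) (x : Rn n) : 0 ≤ mollifier n k x :=
  (mollifierBump n k).nonneg_normed x

theorem integral_mollifier (n k : ℕ) : ∫ x, mollifier n k x = 1 :=
  (mollifierBump n k).integral_normed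

theorem contDiff_mollifier (n k : ℕ) {m : ℕ∞} : ContDiff ℝ m (mollifier n k) :=
  (mollifierBump n k).contDiff_normed

theorem hasCompactSupport_mollifier (n k : ℕ) : HasCompactSupport (mollifier n k) :=
  (mollifierBump n k).hasCompactSupport_normed

theorem continuous_mollifier (n k : ℕ) : Continuous (mollifier n k) :=
  (mollifierBump n k).continuous_normed

theorem integrable_mollifier (n k : ℕ) : Integrable (mollifier n k) :=
  (mollifierBump n k).integrable_normed

theorem norm_lt_of_mollifier_ne_zero {k : ℕ} {x : Rn n} (h : mollifier n k x ≠ 0) :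
    ‖x‖ < 1 / ((k : ℝ) + 1) := by
  have : x ∈ Function.support ((mollifierBump n k).normed volume) := h
  rw [ContDiffBump.support_normed_eq] at this
  simpa [mollifierBump] using this

/-- The ratio of outer to inner radius is always 2, so the sup of the normalised bump is comparable
to the inverse volume of its supporting ball. -/
theorem exists_mollifier_le (n : ℕ) :
    ∃ D : ℝ, 0 ≤ D ∧ ∀ k (x : Rn n), mollifier n k x ≤ D * ((k : ℝ) + 1) ^ n := by
  refine ⟨2 ^ n / (volume : Measure (Rn n)).real (ball 0 1), by positivity, fun k x => ?_⟩
  have h := (mollifierBump n k).normed_le_div_measure_closedBall_rOut volume 2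
    (by simp only [mollifierBump]; apply le_of_eq; field_simp) x
  refine h.trans (le_of_eq ?_)
  have hr : (0 : ℝ) ≤ 1 / ((k : ℝ) + 1) := by positivity
  have h2 : (volume : Measure (Rn n)).real (closedBall 0 (mollifierBump n k).rOut)
      = (1 / ((k : ℝ) + 1)) ^ n * (volume : Measure (Rn n)).real (ball 0 1) := by
    have := Measure.addHaar_real_closedBall (volume : Measure (Rn n)) 0 hr
    simpa [mollifierBump] using this
  rw [h2, finrank_euclideanSpace_fin, one_div, inv_pow]
  field_simp

theorem convolutionExists_mollifier (k : ℕ) {v : Rn n → F} (hv : LocallyIntegrable v) (x : Rn n) :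
    Integrable fun t => mollifier n k t • v (x - t) :=
  (hasCompactSupport_mollifier n k).convolutionExists_left (lsmul ℝ ℝ)
    (continuous_mollifier n k) hv x

theorem contDiff_mollify (k : ℕ) {v : Rn n → F} (hv : LocallyIntegrable v) {m : ℕ∞} :
    ContDiff ℝ m (mollify k v) :=
  (hasCompactSupport_mollifier n k).contDiff_convolution_left _ (contDiff_mollifier n k) hv

theorem ae_tendsto_mollify [CompleteSpace F] {v : Rn n → F} (hv : LocallyIntegrable v) :
    ∀ᵐ x, Tendsto (fun k => mollify k v x) atTop (𝓝 (v x)) := by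
  refine ContDiffBump.ae_convolution_tendsto_right_of_locallyIntegrable
    (φ := fun k => mollifierBump n k) (K := 2) ?_ (.of_forall fun k => ?_) hv
  · exact tendsto_one_div_add_atTop_nhds_zero_nat
  · simp only [mollifierBump]; apply le_of_eq; field_simp

theorem integrable_mollify (k : ℕ) {v : Rn n → ℝ} (hv : Integrable v) :
    Integrable (mollify k v) :=
  (integrable_mollifier n k).integrable_convolution _ hv

theorem integral_mollify (k : ℕ) {v : Rn n → ℝ} (hv : Integrable v) :
    ∫ x, mollify k v x = ∫ x, v x := by
  have := integral_convolution (lsmul ℝ ℝ) (integrable_mollifier n k) hv (μ := volume)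
  rw [integral_mollifier] at this
  simpa [mollify] using this

theorem ae_comp_sub_left {P : Rn n → Prop} (h : ∀ᵐ x, P x) (x : Rn n) : ∀ᵐ t, P (x - t) :=
  (Measure.measurePreserving_sub_left volume x).quasiMeasurePreserving.ae h

theorem abs_mollify_le (k : ℕ) {u : Rn n → ℝ} {M : ℝ} (hu : ∀ᵐ x, |u x| ≤ M) (x : Rn n) :
    |mollify k u x| ≤ M := by
  rw [mollify_apply, ← Real.norm_eq_abs]
  calc ‖∫ t, mollifier n k t • u (x - t)‖ ≤ ∫ t, M * mollifier n k t := by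
        refine norm_integral_le_of_norm_le ((integrable_mollifier n k).const_mul M) ?_
        filter_upwards [ae_comp_sub_left hu x] with t ht
        rw [norm_smul, Real.norm_eq_abs, Real.norm_eq_abs, abs_of_nonneg (mollifier_nonneg k t),
          mul_comm]
        exact mul_le_mul_of_nonneg_right ht (mollifier_nonneg k t)
    _ = M := by rw [integral_const_mul, integral_mollifier, mul_one]

theorem inner_gradient_eq (φ : Rn n → ℝ) (x v : Rn n) :
    inner ℝ (gradient φ x) v = fderiv ℝ φ x v := by
  simp [gradient]

/-- The gradient of the mollification is the mollification of the weak gradient. -/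
theorem fderiv_mollify_apply (k : ℕ) {u : Rn n → ℝ} {g : Rn n → Rn n} (hu : IsWeakGradient u g)
    (x v : Rn n) : fderiv ℝ (mollify k u) x v = inner ℝ (mollify k g x) v := by
  obtain ⟨hu0, hg, hw⟩ := hu
  have hρ1 : ContDiff ℝ 1 (mollifier n k) := contDiff_mollifier n k (m := 1)
  have hd := (hasCompactSupport_mollifier n k).hasFDerivAt_convolution_left (lsmul ℝ ℝ)
    (μ := volume) hρ1 hu0 x
  have hex : Integrable fun t => ((lsmul ℝ ℝ : ℝ →L[ℝ] ℝ →L[ℝ] ℝ).precompL (Rn n))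
      (fderiv ℝ (mollifier n k) t) (u (x - t)) :=
    ((hasCompactSupport_mollifier n k).fderiv ℝ).convolutionExists_left _
      (hρ1.continuous_fderiv one_ne_zero) hu0 x
  have h1 : fderiv ℝ (mollify k u) x v
      = ∫ t, fderiv ℝ (mollifier n k) t v * u (x - t) := by
    rw [mollify, hd.fderiv, convolution_def, ContinuousLinearMap.integral_apply hex]
    simp [precompL_apply]
  have h2 : ∫ t, fderiv ℝ (mollifier n k) t v * u (x - t)
      = ∫ y, fderiv ℝ (mollifier n k) (x - y) v * u y := by
    rw [← integral_sub_left_eq_self _ volume x]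
    simp
  -- Reflecting the kernel produces a test function in `y`; the sign from the reflection cancels the
  -- sign in the definition of the weak gradient.
  have hφ : IsTestFunction fun y => mollifier n k (x - y) := by
    refine ⟨(contDiff_mollifier n k (m := ⊤)).comp (contDiff_const.sub contDiff_id), ?_⟩
    exact (hasCompactSupport_mollifier n k).comp_homeomorph (Homeomorph.subLeft x)
  have h3 := hw _ hφ v
  have h4 : ∀ y, inner ℝ (gradient (fun y => mollifier n k (x - y)) y) v
      = -fderiv ℝ (mollifier n k) (x - y) v := by
    intro y
    have hd1 : HasFDerivAt (fun y => x - y) (-ContinuousLinearMap.id ℝ (Rn n)) y :=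
      (hasFDerivAt_id y).const_sub x
    have hd2 := ((hρ1.differentiable one_ne_zero (x - y)).hasFDerivAt.comp y hd1).fderiv
    rw [inner_gradient_eq]
    change fderiv ℝ (mollifier n k ∘ fun y => x - y) y v = _
    rw [hd2]
    simp
  have h5 : inner ℝ (mollify k g x) v = ∫ y, mollifier n k (x - y) * inner ℝ (g y) v := by
    rw [mollify_apply, real_inner_comm, ← integral_inner (convolutionExists_mollifier k hg x),
      ← integral_sub_left_eq_self _ volume x]
    refine integral_congr_ae (.of_forall fun y => ?_)
    simp [inner_smul_right, real_inner_comm]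
  simp only [h4] at h3
  rw [h1, h2, h5]
  have h6 : ∫ y, u y * -(fderiv ℝ (mollifier n k) (x - y)) v
      = -∫ y, fderiv ℝ (mollifier n k) (x - y) v * u y := by
    rw [← integral_neg]
    exact integral_congr_ae (.of_forall fun y => by simp; ring)
  linarith

/-- The maximal-type estimate `|ρ_k ⋆ g|^{p(x)} ≤ C (1 + ρ_k ⋆ (1_S |g|^p))` for a log-Hölder
exponent. -/
theorem exists_norm_mollify_rpow_le {p : Rn n → ℝ} (hp : IsLogHolderExponent p) {g : Rn n → F}
    (hg : LocallyIntegrable g) {S : Set (Rn n)}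
    (hH : Integrable (S.indicator fun y => ‖g y‖ ^ p y)) :
    ∃ C : ℝ, 0 ≤ C ∧ ∀ k x, closedBall x 1 ⊆ S →
      ‖mollify k g x‖ ^ p x ≤ C * (1 + mollify k (S.indicator fun y => ‖g y‖ ^ p y) x) := by
  obtain ⟨P, hP⟩ := hp.exists_upper_bound
  obtain ⟨L, hL, hlog⟩ := hp.logHolder
  obtain ⟨D, hD, hDb⟩ := exists_mollifier_le n
  set H := S.indicator fun y => ‖g y‖ ^ p y with hHdef
  have hH0 : ∀ y, 0 ≤ H y := fun y =>
    Set.indicator_nonneg (fun y _ => Real.rpow_nonneg (norm_nonneg _) _) y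
  have hI : 0 ≤ ∫ y, H y := integral_nonneg hH0
  have hP1 : 1 ≤ P := (hp.one_le 0).trans (hP 0)
  -- Chosen so that `1 + ρ_k ⋆ H ≤ B (1/ε)^n` at the scale `ε = 1/(k+1)`, using `ρ_k ≤ D (k+1)^n`.
  set B := 1 + D * ∫ y, H y with hBdef
  have hB : 1 ≤ B := by have := mul_nonneg hD hI; linarith
  set C₀ := Real.exp (P * L * (Real.log B + n)) with hC0
  have hC0' : 0 < C₀ := Real.exp_pos _
  refine ⟨(1 + C₀) ^ P, by positivity, fun k x hx => ?_⟩
  have hε : (0 : ℝ) < 1 / ((k : ℝ) + 1) := by positivity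
  have hε1 : 1 / ((k : ℝ) + 1) ≤ 1 := by
    rw [div_le_one (by positivity)]; linarith [(Nat.cast_nonneg k : (0 : ℝ) ≤ k)]
  -- The kernel lives in a ball of radius at most 1 and `closedBall x 1 ⊆ S`, so the indicator is
  -- invisible to it.
  have heq : ∀ t, mollifier n k t * ‖g (x - t)‖ ^ p (x - t) = mollifier n k t * H (x - t) := by
    intro t
    rcases eq_or_ne (mollifier n k t) 0 with h0 | h0
    · simp [h0]
    · have ht := norm_lt_of_mollifier_ne_zero h0
      have hmem : x - t ∈ S := hx (by simpa using ht.le.trans hε1)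
      rw [hHdef, Set.indicator_of_mem hmem]
  have hiH := convolutionExists_mollifier k hH.locallyIntegrable x
  have hmH : mollify k H x = ∫ t, mollifier n k t * ‖g (x - t)‖ ^ p (x - t) := by
    simp only [heq]; rfl
  have hmH0 : 0 ≤ mollify k H x :=
    integral_nonneg fun t => mul_nonneg (mollifier_nonneg k t) (hH0 _)
  have hmB : 1 + mollify k H x ≤ B * (1 / (1 / ((k : ℝ) + 1))) ^ n := by
    rw [one_div_one_div]
    have h1 : mollify k H x ≤ D * ((k : ℝ) + 1) ^ n * ∫ y, H y := by
      rw [mollify_apply, ← integral_sub_left_eq_self H volume x, ← integral_const_mul]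
      refine integral_mono hiH ((hH.comp_sub_left x).const_mul _) fun t => ?_
      exact mul_le_mul_of_nonneg_right (hDb k t) (hH0 _)
    have h2 : (1 : ℝ) ≤ ((k : ℝ) + 1) ^ n := one_le_pow₀ (by simp)
    rw [hBdef, add_mul]
    nlinarith
  have hgn : Integrable fun t => mollifier n k t * ‖g (x - t)‖ := by
    have := (convolutionExists_mollifier k hg x).norm
    refine this.congr (.of_forall fun t => ?_)
    simp [norm_smul, abs_of_nonneg (mollifier_nonneg k t)]
  have key := integral_rpow_le_of_rpow_le (μ := volume) (w := mollifier n k)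
    (F := fun t => ‖g (x - t)‖) (s := fun t => p (x - t)) (r := p x) (C := C₀)
    (mollifier_nonneg k) (integral_mollifier n k) (fun t => norm_nonneg _)
    (fun t => hp.one_le _) (hp.one_le x) hC0'.le (integrable_mollifier n k) hgn
    (hiH.congr (.of_forall fun t => (heq t).symm)) (by
      intro t ht
      rw [← hmH]
      refine rpow_le_exp_of_le_div_log (by linarith) hε hB hmB (by positivity) ?_
      have hpx : 0 < p x := by linarith [hp.one_le x]
      have hpt : 0 < p (x - t) := by linarith [hp.one_le (x - t)]
      -- This form of the exponent exposes the increment of `1/p`, the quantity controlled by the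
      -- log-Hölder condition.
      have h1 : 1 - p (x - t) / p x = p (x - t) * (1 / p (x - t) - 1 / p x) := by
        field_simp
      have h2 := abs_sub_le_of_logHolder hL hlog (x := x - t) (y := x) hε
        (by simpa using (norm_lt_of_mollifier_ne_zero ht).le)
      have h3 := (le_abs_self _).trans h2
      have hl := one_le_log_exp_one_add (t := 1 / (1 / ((k : ℝ) + 1))) (by positivity)
      rw [h1, mul_div_assoc]
      calc _ ≤ p (x - t) * (L / Real.log (Real.exp 1 + 1 / (1 / ((k : ℝ) + 1)))) := by gcongr
        _ ≤ _ := by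
          gcongr
          exact hP _)
  rw [← hmH] at key
  calc ‖mollify k g x‖ ^ p x ≤ (∫ t, mollifier n k t * ‖g (x - t)‖) ^ p x := by
        refine Real.rpow_le_rpow (norm_nonneg _) ?_ (by linarith [hp.one_le x])
        rw [mollify_apply]
        refine (norm_integral_le_integral_norm _).trans (le_of_eq ?_)
        refine integral_congr_ae (.of_forall fun t => ?_)
        simp [norm_smul, abs_of_nonneg (mollifier_nonneg k t)]
    _ ≤ (1 + C₀) ^ p x * (1 + mollify k H x) := key
    _ ≤ (1 + C₀) ^ P * (1 + mollify k H x) := by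
        gcongr
        · linarith
        · exact hP x

end

/-! ### The weak inequality tested with `ζ (u + M)` -/

theorem rpow_sub_one_mul_self {X s : ℝ} (hX : 0 ≤ X) (hs : 1 ≤ s) :
    X ^ (s - 1) * X = X ^ s := by
  rcases hX.eq_or_lt with rfl | h
  · rw [mul_zero, Real.zero_rpow (by linarith)]
  · rw [Real.rpow_sub_one h.ne']; field_simp

/-- A crude Young inequality with constant 1 for every exponent: replace the smaller of `X`, `Y` by
the larger. -/
theorem rpow_sub_one_mul_le {X Y s : ℝ} (hX : 0 ≤ X) (hY : 0 ≤ Y) (hs : 1 ≤ s) :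
    X ^ (s - 1) * Y ≤ X ^ s + Y ^ s := by
  have h1 := Real.rpow_nonneg hX s
  have h2 := Real.rpow_nonneg hY s
  rcases le_total Y X with h | h
  · have := mul_le_mul_of_nonneg_left h (Real.rpow_nonneg hX (s - 1))
    rw [rpow_sub_one_mul_self hX hs] at this
    linarith
  · have := mul_le_mul_of_nonneg_right (Real.rpow_le_rpow hX h (by linarith : 0 ≤ s - 1)) hY
    rw [rpow_sub_one_mul_self hY hs] at this
    linarith

theorem MemVarLp.integrableOn_norm_rpow {n : ℕ} {F : Type*} [NormedAddCommGroup F]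
    [NormedSpace ℝ F] {p : Rn n → ℝ} {P : ℝ} {S : Set (Rn n)} {v : Rn n → F}
    (hp : Continuous p) (hp1 : ∀ x, 1 ≤ p x) (hP : ∀ x, p x ≤ P) (hv : MemVarLp p S v) :
    IntegrableOn (fun x => ‖v x‖ ^ p x) S := by
  obtain ⟨hm, μ, hμ, hfin⟩ := hv
  have hm1 : AEStronglyMeasurable (fun x => ‖v x‖ ^ p x) (volume.restrict S) :=
    (hm.norm.aemeasurable.pow hp.measurable.aemeasurable).aestronglyMeasurable
  have hm2 : AEStronglyMeasurable (fun x => ‖μ⁻¹ • v x‖ ^ p x) (volume.restrict S) :=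
    ((hm.const_smul μ⁻¹).norm.aemeasurable.pow hp.measurable.aemeasurable).aestronglyMeasurable
  have hi : Integrable (fun x => ‖μ⁻¹ • v x‖ ^ p x) (volume.restrict S) :=
    ⟨hm2, (hasFiniteIntegral_iff_ofReal
      (.of_forall fun x => Real.rpow_nonneg (norm_nonneg _) _)).2 hfin⟩
  -- The base is `1 + μ` because `μ ^ p x ≤ μ ^ P` can fail when `μ < 1`.
  refine (hi.const_mul ((1 + μ) ^ P)).mono' hm1 (.of_forall fun x => ?_)
  have h1 : ‖v x‖ = μ * ‖μ⁻¹ • v x‖ := by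
    rw [norm_smul, norm_inv, Real.norm_of_nonneg hμ.le]; field_simp
  rw [Real.norm_of_nonneg (Real.rpow_nonneg (norm_nonneg _) _), h1,
    Real.mul_rpow hμ.le (norm_nonneg _)]
  gcongr
  calc μ ^ p x ≤ (1 + μ) ^ p x :=
        Real.rpow_le_rpow hμ.le (by linarith) (by linarith [hp1 x])
    _ ≤ (1 + μ) ^ P := Real.rpow_le_rpow_of_exponent_le (by linarith) (hP x)

theorem IsCaratheodory.aestronglyMeasurable_comp {n : ℕ} {A : Rn n → ℝ → Rn n → Rn n}
    (hA : IsCaratheodory A) {u : Rn n → ℝ} {g : Rn n → Rn n} (hu : AEStronglyMeasurable u)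
    (hg : AEStronglyMeasurable g) : AEStronglyMeasurable fun x => A x (u x) (g x) := by
  have h := measurable_uncurry_of_continuous_of_measurable
    (u := fun (z : ℝ × Rn n) (x : Rn n) => A x z.1 z.2) hA.continuous
    (fun z => hA.measurable z.1 z.2)
  exact (h.comp_aemeasurable
    ((hu.aemeasurable.prodMk hg.aemeasurable).prodMk aemeasurable_id)).aestronglyMeasurable

/-- A Fatou lemma with a convergent sequence of majorants. -/
theorem integral_le_of_tendsto_of_dominated {X : Type*} [MeasurableSpace X] {μ : Measure X}
    {h F : ℕ → X → ℝ} {h₀ F₀ : X → ℝ} {c : ℕ → ℝ} {c₀ : ℝ}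
    (hh : ∀ k, Integrable (h k) μ) (hh₀ : Integrable h₀ μ)
    (hF : ∀ k, Integrable (F k) μ) (hF₀ : Integrable F₀ μ)
    (hle : ∀ k, ∀ᵐ x ∂μ, |h k x| ≤ F k x)
    (hlim : ∀ᵐ x ∂μ, Tendsto (fun k => h k x) atTop (𝓝 (h₀ x)))
    (hFlim : ∀ᵐ x ∂μ, Tendsto (fun k => F k x) atTop (𝓝 (F₀ x)))
    (hFint : ∀ k, ∫ x, F k x ∂μ = ∫ x, F₀ x ∂μ)
    (hc : ∀ k, ∫ x, h k x ∂μ ≤ c k) (hclim : Tendsto c atTop (𝓝 c₀)) :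
    ∫ x, h₀ x ∂μ ≤ c₀ := by
  have hle' : ∀ᵐ x ∂μ, ∀ k, |h k x| ≤ F k x := ae_all_iff.2 hle
  -- Fatou is applied to the nonnegative functions `F k + h k`; since all `F k` have the integral of
  -- `F₀`, that term can be subtracted at the end.
  have hnn : ∀ k, 0 ≤ᵐ[μ] fun x => F k x + h k x := fun k => by
    filter_upwards [hle k] with x hx
    have := neg_le_of_abs_le hx
    simp only [Pi.zero_apply]; linarith
  have hnn₀ : 0 ≤ᵐ[μ] fun x => F₀ x + h₀ x := by
    filter_upwards [hle', hlim, hFlim] with x h1 h2 h3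
    refine ge_of_tendsto' (a := F₀ x + h₀ x) (b := (0 : ℝ)) (h3.add h2) fun k => ?_
    have := neg_le_of_abs_le (h1 k)
    linarith
  have hk : ∀ k, ∫ x, (F k x + h k x) ∂μ ≤ ∫ x, F₀ x ∂μ + c k := fun k => by
    rw [integral_add (hF k) (hh k), hFint]
    linarith [hc k]
  have hpos : 0 ≤ ∫ x, F₀ x ∂μ + c₀ :=
    ge_of_tendsto' (hclim.const_add _) fun k => (integral_nonneg_of_ae (hnn k)).trans (hk k)
  have key : ENNReal.ofReal (∫ x, (F₀ x + h₀ x) ∂μ) ≤ ENNReal.ofReal (∫ x, F₀ x ∂μ + c₀) := by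
    have hi₀ : Integrable (fun x => F₀ x + h₀ x) μ := hF₀.add hh₀
    have hi : ∀ k, Integrable (fun x => F k x + h k x) μ := fun k => (hF k).add (hh k)
    rw [ofReal_integral_eq_lintegral_ofReal hi₀ hnn₀]
    calc ∫⁻ x, ENNReal.ofReal (F₀ x + h₀ x) ∂μ
        = ∫⁻ x, liminf (fun k => ENNReal.ofReal (F k x + h k x)) atTop ∂μ := by
          refine lintegral_congr_ae ?_
          filter_upwards [hlim, hFlim] with x h2 h3
          exact ((ENNReal.continuous_ofReal.tendsto _).comp (h3.add h2)).liminf_eq.symm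
      _ ≤ liminf (fun k => ∫⁻ x, ENNReal.ofReal (F k x + h k x) ∂μ) atTop :=
          lintegral_liminf_le' fun k => (hi k).aemeasurable.ennreal_ofReal
      _ ≤ liminf (fun k => ENNReal.ofReal (∫ x, F₀ x ∂μ + c k)) atTop := by
          refine liminf_le_liminf (.of_forall fun k => ?_)
          rw [← ofReal_integral_eq_lintegral_ofReal (hi k) (hnn k)]
          exact ENNReal.ofReal_le_ofReal (hk k)
      _ = _ := ((ENNReal.continuous_ofReal.tendsto _).comp (hclim.const_add _)).liminf_eq
  rw [ENNReal.ofReal_le_ofReal_iff hpos, integral_add hF₀ hh₀] at key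
  linarith

section
variable {n : ℕ} {p : Rn n → ℝ} {u : Rn n → ℝ} {g a : Rn n → Rn n} {b M : ℝ}

theorem locallyIntegrable_flux (hp1 : ∀ x, 1 ≤ p x)
    (hgp : LocallyIntegrable fun x => ‖g x‖ ^ p x) (ha : AEStronglyMeasurable a) (hb : 0 ≤ b)
    (hab : ∀ x, ‖a x‖ ≤ b * ‖g x‖ ^ (p x - 1)) : LocallyIntegrable a := by
  have h1 : LocallyIntegrable fun x => b * (‖g x‖ ^ p x + 1) :=
    (hgp.add (locallyIntegrable_const 1)).smul b
  refine h1.mono ha (.of_forall fun x => ?_)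
  refine (hab x).trans ((mul_le_mul_of_nonneg_left ?_ hb).trans (le_abs_self _))
  simpa using rpow_sub_one_mul_le (norm_nonneg (g x)) zero_le_one (hp1 x)

theorem IsTestFunction.continuous {φ : Rn n → ℝ} (hφ : IsTestFunction φ) : Continuous φ :=
  hφ.1.continuous

theorem IsTestFunction.continuous_fderiv {φ : Rn n → ℝ} (hφ : IsTestFunction φ) :
    Continuous (fderiv ℝ φ) :=
  hφ.1.continuous_fderiv (by simp)

theorem integrable_mul_fderiv_apply {ζ w : Rn n → ℝ} (hζ : IsTestFunction ζ)
    (ha : LocallyIntegrable a) (hw : AEStronglyMeasurable w) {C : ℝ} (hwC : ∀ᵐ x, |w x| ≤ C) :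
    Integrable fun x => w x * fderiv ℝ ζ x (a x) := by
  have h1 : Integrable fun x => ‖fderiv ℝ ζ x‖ • a x :=
    ha.integrable_smul_left_of_hasCompactSupport hζ.continuous_fderiv.norm (hζ.2.fderiv ℝ).norm
  have hm : AEStronglyMeasurable fun x => fderiv ℝ ζ x (a x) :=
    (ContinuousLinearMap.apply ℝ ℝ : Rn n →L[ℝ] _).aestronglyMeasurable_comp₂ ha.aestronglyMeasurable
      hζ.continuous_fderiv.aestronglyMeasurable
  refine (h1.norm.const_mul C).mono' (hw.mul hm) ?_
  filter_upwards [hwC] with x hx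
  rw [norm_mul, norm_smul, norm_norm]
  exact mul_le_mul hx ((fderiv ℝ ζ x).le_opNorm _) (norm_nonneg _) ((abs_nonneg _).trans hx)

/-- A bounded weak subsolution may be tested with `ζ (u + M)`. -/
theorem integral_inner_mul_le (hp : IsLogHolderExponent p) (hu : IsWeakGradient u g)
    (hgp : LocallyIntegrable fun x => ‖g x‖ ^ p x) (ha : AEStronglyMeasurable a) (hb : 0 ≤ b)
    (hab : ∀ x, ‖a x‖ ≤ b * ‖g x‖ ^ (p x - 1)) (hM : ∀ᵐ x, |u x| ≤ M)
    (hweak : ∀ φ : Rn n → ℝ, IsTestFunction φ → (∀ x, 0 ≤ φ x) →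
      ∫ x, fderiv ℝ φ x (a x) ≤ 0)
    {ζ : Rn n → ℝ} (hζ : IsTestFunction ζ) (hζ0 : ∀ x, 0 ≤ ζ x) :
    Integrable (fun x => ζ x * inner ℝ (g x) (a x)) ∧
    ∫ x, ζ x * inner ℝ (g x) (a x) ≤ -∫ x, (u x + M) * fderiv ℝ ζ x (a x) := by
  obtain ⟨hu0, hg, -⟩ := id hu
  have hM0 : 0 ≤ M := (abs_nonneg _).trans (abs_mollify_le 0 hM 0)
  have hal : LocallyIntegrable a := locallyIntegrable_flux hp.one_le hgp ha hb hab
  obtain ⟨R, hR⟩ := hζ.2.isBounded.subset_closedBall (0 : Rn n)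
  -- The margin 1 is the largest mollification radius, so unit balls centred in the support of `ζ`
  -- stay inside `S`.
  set S := closedBall (0 : Rn n) (R + 1) with hSdef
  have hSm : MeasurableSet S := isClosed_closedBall.measurableSet
  have hSc : IsCompact S := isCompact_closedBall _ _
  set H := S.indicator fun y => ‖g y‖ ^ p y with hHdef
  have hH : Integrable H := (hgp.integrableOn_isCompact hSc).integrable_indicator hSm
  have hH0 : ∀ y, 0 ≤ H y := fun y =>
    Set.indicator_nonneg (fun y _ => Real.rpow_nonneg (norm_nonneg _) _) y
  obtain ⟨C, hC, hCb⟩ := exists_norm_mollify_rpow_le hp hg hH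
  obtain ⟨Z, hZ⟩ := hζ.continuous.bounded_above_of_compact_support hζ.2
  have hZ0 : 0 ≤ Z := (norm_nonneg _).trans (hZ 0)
  set J : Rn n → ℝ := S.indicator fun _ => 1 with hJdef
  have hJ : Integrable J :=
    (integrable_indicator_iff hSm).2 (integrableOn_const hSc.measure_lt_top.ne)
  have hJ0 : ∀ y, 0 ≤ J y := fun y => Set.indicator_nonneg (fun y _ => zero_le_one) y
  have hmH0 : ∀ k x, 0 ≤ mollify k H x := fun k x =>
    integral_nonneg fun t => mul_nonneg (mollifier_nonneg k t) (hH0 _)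
  -- The majorant of `|h k|` from the growth of `a`, Young and the maximal-type estimate. The
  -- indicator `J` makes the constant 1 integrable, and mollification preserves the integral of `H`,
  -- so `∫ F k` does not depend on `k`.
  set F : ℕ → Rn n → ℝ := fun k x => Z * b * (H x + C * (J x + mollify k H x)) with hFdef
  set F₀ : Rn n → ℝ := fun x => Z * b * (H x + C * (J x + H x)) with hF₀def
  have hF : ∀ k, Integrable (F k) := fun k =>
    (hH.add ((hJ.add (integrable_mollify k hH)).const_mul C)).const_mul _
  have hF₀ : Integrable F₀ := (hH.add ((hJ.add hH).const_mul C)).const_mul _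
  set h : ℕ → Rn n → ℝ := fun k x => ζ x * inner ℝ (mollify k g x) (a x) with hhdef
  have hbound : ∀ k x, |h k x| ≤ F k x := by
    intro k x
    by_cases hx : ζ x = 0
    · simp only [hhdef, hFdef, hx, zero_mul, abs_zero]
      have := hH0 x; have := hJ0 x; have := hmH0 k x
      positivity
    · have hxR : x ∈ closedBall (0 : Rn n) R := hR (subset_tsupport _ hx)
      have hxS : closedBall x 1 ⊆ S := by
        refine closedBall_subset_closedBall' ?_
        have := mem_closedBall.1 hxR
        linarith
      have hxS' : x ∈ S := hxS (mem_closedBall_self zero_le_one)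
      have hHx : H x = ‖g x‖ ^ p x := Set.indicator_of_mem hxS' _
      have hJx : J x = 1 := Set.indicator_of_mem hxS' _
      have h1 : |inner ℝ (mollify k g x) (a x)|
          ≤ b * (‖g x‖ ^ p x + ‖mollify k g x‖ ^ p x) := by
        calc |inner ℝ (mollify k g x) (a x)| ≤ ‖mollify k g x‖ * ‖a x‖ :=
              abs_real_inner_le_norm _ _
          _ ≤ ‖mollify k g x‖ * (b * ‖g x‖ ^ (p x - 1)) := by
              gcongr; exact hab x
          _ = b * (‖g x‖ ^ (p x - 1) * ‖mollify k g x‖) := by ring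
          _ ≤ _ := by
              gcongr
              exact rpow_sub_one_mul_le (norm_nonneg _) (norm_nonneg _) (hp.one_le x)
      have h2 := hCb k x hxS
      have h3 : |ζ x| ≤ Z := hZ x
      simp only [hhdef, hFdef, abs_mul, hHx, hJx]
      calc |ζ x| * |inner ℝ (mollify k g x) (a x)|
          ≤ Z * (b * (‖g x‖ ^ p x + C * (1 + mollify k H x))) := by
            refine mul_le_mul h3 (h1.trans ?_) (abs_nonneg _) hZ0
            gcongr
        _ = _ := by ring
  have hmeas : ∀ {v : Rn n → Rn n}, AEStronglyMeasurable v →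
      AEStronglyMeasurable fun x => ζ x * inner ℝ (v x) (a x) := fun hv =>
    hζ.continuous.aestronglyMeasurable.mul (hv.inner ha)
  have hh : ∀ k, Integrable (h k) := fun k =>
    (hF k).mono' (hmeas (contDiff_mollify k hg (m := 0)).continuous.aestronglyMeasurable)
      (.of_forall fun x => hbound k x)
  have hlim : ∀ᵐ x, Tendsto (fun k => h k x) atTop (𝓝 (ζ x * inner ℝ (g x) (a x))) := by
    filter_upwards [ae_tendsto_mollify hg] with x hx
    exact (hx.inner tendsto_const_nhds).const_mul _
  have hFlim : ∀ᵐ x, Tendsto (fun k => F k x) atTop (𝓝 (F₀ x)) := by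
    filter_upwards [ae_tendsto_mollify hH.locallyIntegrable] with x hx
    exact (((hx.const_add _).const_mul _).const_add _).const_mul _
  have hh₀ : Integrable fun x => ζ x * inner ℝ (g x) (a x) := by
    refine hF₀.mono' (hmeas hg.aestronglyMeasurable) ?_
    filter_upwards [hlim, hFlim] with x h1 h2
    exact le_of_tendsto_of_tendsto' h1.abs h2 fun k => hbound k x
  have hMk : ∀ k x, |mollify k u x + M| ≤ 2 * M := fun k x => by
    have := abs_le.1 (abs_mollify_le k hM x)
    rw [abs_le]; constructor <;> linarith
  have hcd : ∀ k, ContDiff ℝ ∞ (mollify k u) := fun k => contDiff_mollify k hu0 (m := ⊤)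
  have hwm : ∀ k, AEStronglyMeasurable fun x => mollify k u x + M := fun k =>
    ((hcd k).continuous.add continuous_const).aestronglyMeasurable
  have hck : ∀ k, Integrable fun x => (mollify k u x + M) * fderiv ℝ ζ x (a x) := fun k =>
    integrable_mul_fderiv_apply hζ hal (hwm k) (.of_forall (hMk k))
  refine ⟨hh₀, integral_le_of_tendsto_of_dominated
    (c := fun k => -∫ x, (mollify k u x + M) * fderiv ℝ ζ x (a x)) hh hh₀ hF hF₀
    (fun k => .of_forall (hbound k)) hlim hFlim (fun k => ?_) (fun k => ?_) ?_⟩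
  · have hsum : ∀ {G : Rn n → ℝ}, Integrable G → ∫ x, Z * b * (H x + C * (J x + G x))
        = Z * b * ((∫ x, H x) + C * ((∫ x, J x) + ∫ x, G x)) := fun {G} hG => by
      have hJG : Integrable fun x => C * (J x + G x) := (hJ.add hG).const_mul C
      rw [integral_const_mul, integral_add hH hJG, integral_const_mul, integral_add hJ hG]
    simp only [hFdef, hF₀def]
    rw [hsum (integrable_mollify k hH), hsum hH, integral_mollify k hH]
  · have hφ : IsTestFunction fun x => ζ x * (mollify k u x + M) :=
      ⟨hζ.1.mul ((hcd k).add contDiff_const), hζ.2.mul_right⟩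
    have h1 := hweak _ hφ fun x =>
      mul_nonneg (hζ0 x) (by linarith [(abs_le.1 (abs_mollify_le k hM x)).1])
    have h2 : ∀ x, fderiv ℝ (fun x => ζ x * (mollify k u x + M)) x (a x)
        = h k x + (mollify k u x + M) * fderiv ℝ ζ x (a x) := by
      intro x
      have hd1 : DifferentiableAt ℝ ζ x := hζ.1.differentiable (by simp) x
      have hd2 : DifferentiableAt ℝ (mollify k u) x := (hcd k).differentiable (by simp) x
      rw [fderiv_fun_mul hd1 (hd2.add_const M), fderiv_add_const]
      simp [hhdef, fderiv_mollify_apply k hu]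
    simp only [h2] at h1
    rw [integral_add (hh k) (hck k)] at h1
    linarith
  · refine Tendsto.neg ?_
    have h1 : Integrable fun x => ‖(2 * M) * fderiv ℝ ζ x (a x)‖ :=
      (integrable_mul_fderiv_apply hζ hal (aestronglyMeasurable_const (b := 2 * M))
        (.of_forall fun _ => le_refl _)).norm
    refine tendsto_integral_of_dominated_convergence _ (fun k => (hck k).aestronglyMeasurable) h1
      (fun k => .of_forall fun x => ?_) ?_
    · rw [norm_mul, norm_mul, Real.norm_of_nonneg (by linarith : 0 ≤ 2 * M)]
      exact mul_le_mul_of_nonneg_right (hMk k x) (norm_nonneg _)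
    · filter_upwards [ae_tendsto_mollify hu0] with x hx
      exact (hx.add_const M).mul_const _

end

/-! ### The Caccioppoli estimate and the conclusion -/

/-- Young's inequality with absorption, its constants uniform in `s`. If `Y ≤ Xη/2`, the product is
at most half of the main term; otherwise `Xη < 2Y` up to equality, and `s - 1 ≤ l` with `η ≤ 1`
gives `η^l ≤ η^(s-1)`, so everything is bounded by `(2Y)^s`. -/
theorem rpow_sub_one_mul_pow_mul_le {X Y η s : ℝ} {l : ℕ} (hX : 0 ≤ X) (hY : 0 ≤ Y) (hη : 0 ≤ η)
    (hη1 : η ≤ 1) (hs : 1 ≤ s) (hl : 1 ≤ l) (hsl : s ≤ l + 1) :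
    X ^ (s - 1) * η ^ l * Y ≤ 1 / 2 * (X ^ s * η ^ (l + 1)) + (2 * Y) ^ s := by
  have h1 : 0 ≤ X ^ s * η ^ (l + 1) := mul_nonneg (Real.rpow_nonneg hX _) (pow_nonneg hη _)
  have h2 : 0 ≤ (2 * Y) ^ s := Real.rpow_nonneg (by linarith) _
  rcases hη.eq_or_lt with rfl | hη0
  · rw [zero_pow (by omega)]; linarith
  rcases le_total Y (X * η / 2) with h | h
  · calc X ^ (s - 1) * η ^ l * Y ≤ X ^ (s - 1) * η ^ l * (X * η / 2) := by
          have := Real.rpow_nonneg hX (s - 1)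
          gcongr
      _ = 1 / 2 * ((X ^ (s - 1) * X) * η ^ (l + 1)) := by ring
      _ = 1 / 2 * (X ^ s * η ^ (l + 1)) := by rw [rpow_sub_one_mul_self hX hs]
      _ ≤ _ := by linarith
  · have h3 : η ^ l ≤ η ^ (s - 1) := by
      rw [← Real.rpow_natCast]
      exact Real.rpow_le_rpow_of_exponent_ge hη0 hη1 (by linarith)
    have h4 : X ^ (s - 1) * η ^ l ≤ (2 * Y) ^ (s - 1) := by
      calc X ^ (s - 1) * η ^ l ≤ X ^ (s - 1) * η ^ (s - 1) :=
            mul_le_mul_of_nonneg_left h3 (Real.rpow_nonneg hX _)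
        _ = (X * η) ^ (s - 1) := (Real.mul_rpow hX hη).symm
        _ ≤ _ := Real.rpow_le_rpow (by positivity) (by linarith) (by linarith)
    calc X ^ (s - 1) * η ^ l * Y ≤ (2 * Y) ^ (s - 1) * (2 * Y) :=
          mul_le_mul h4 (by linarith) hY (Real.rpow_nonneg (by linarith) _)
      _ = (2 * Y) ^ s := rpow_sub_one_mul_self (by linarith) hs
      _ ≤ _ := by linarith

/-- Smooth cutoffs between the balls of radii `R` and `2R` with gradient of size `1 / R`. -/
theorem exists_cutoff (n : ℕ) : ∃ G : ℝ, 0 ≤ G ∧ ∀ R : ℝ, 0 < R → ∃ η : Rn n → ℝ,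
    IsTestFunction η ∧ (∀ x, 0 ≤ η x) ∧ (∀ x, η x ≤ 1) ∧ (∀ x ∈ closedBall (0 : Rn n) R, η x = 1) ∧
    (∀ x ∉ closedBall (0 : Rn n) (2 * R), η x = 0) ∧ ∀ x, ‖fderiv ℝ η x‖ ≤ G / R := by
  let β : ContDiffBump (0 : Rn n) := ⟨1, 2, one_pos, one_lt_two⟩
  have hβ : ContDiff ℝ ∞ β := β.contDiff
  obtain ⟨G, hG⟩ := (hβ.continuous_fderiv (by simp)).bounded_above_of_compact_support
    (β.hasCompactSupport.fderiv ℝ)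
  refine ⟨G, (norm_nonneg _).trans (hG 0), fun R hR => ⟨fun x => β (R⁻¹ • x), ⟨?_, ?_⟩,
    fun x => β.nonneg, fun x => β.le_one, fun x hx => ?_, fun x hx => ?_, fun x => ?_⟩⟩
  · exact hβ.comp (contDiff_const_smul R⁻¹)
  · exact β.hasCompactSupport.comp_smul (inv_ne_zero hR.ne')
  · refine β.one_of_mem_closedBall ?_
    rw [mem_closedBall_zero_iff] at hx ⊢
    rw [norm_smul, norm_inv, Real.norm_of_nonneg hR.le]
    change R⁻¹ * ‖x‖ ≤ 1
    rwa [inv_mul_le_iff₀ hR, mul_one]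
  · refine β.zero_of_le_dist ?_
    rw [mem_closedBall_zero_iff, not_le] at hx
    rw [dist_zero_right, norm_smul, norm_inv, Real.norm_of_nonneg hR.le]
    change 2 ≤ R⁻¹ * ‖x‖
    rw [le_inv_mul_iff₀ hR]
    linarith
  · have := fderiv_comp_smul (f := (β : Rn n → ℝ)) (x := x) R⁻¹
    rw [this, norm_smul, norm_inv, Real.norm_of_nonneg hR.le, div_eq_inv_mul]
    exact mul_le_mul_of_nonneg_left (hG _) (inv_nonneg.2 hR.le)

section
variable {n : ℕ} {p : Rn n → ℝ} {u : Rn n → ℝ} {g a : Rn n → Rn n} {α b M : ℝ}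

theorem IsTestFunction.pow_succ {η : Rn n → ℝ} (hη : IsTestFunction η) (l : ℕ) :
    IsTestFunction fun x => η x ^ (l + 1) := by
  refine ⟨hη.1.pow _, hη.2.mono fun x hx h0 => hx ?_⟩
  simp [h0]

/-- Caccioppoli estimate for bounded subsolutions. -/
theorem exists_setIntegral_norm_rpow_le (hp : IsLogHolderExponent p) (hu : IsWeakGradient u g)
    (hgp : LocallyIntegrable fun x => ‖g x‖ ^ p x) (ha : AEStronglyMeasurable a) (hα : 0 < α)
    (hb : 0 ≤ b) (hab : ∀ x, ‖a x‖ ≤ b * ‖g x‖ ^ (p x - 1))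
    (haα : ∀ x, α * ‖g x‖ ^ p x ≤ inner ℝ (g x) (a x)) (hM : ∀ᵐ x, |u x| ≤ M)
    (hweak : ∀ φ : Rn n → ℝ, IsTestFunction φ → (∀ x, 0 ≤ φ x) →
      ∫ x, fderiv ℝ φ x (a x) ≤ 0) :
    ∃ E : ℝ, 0 ≤ E ∧ ∀ R : ℝ, 0 < R → E ≤ R → ∫ x in closedBall (0 : Rn n) R, ‖g x‖ ^ p x ≤
      2 * ((E / R) ^ exponentInf p *
        (volume : Measure (Rn n)).real (closedBall (0 : Rn n) (2 * R))) := by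
  obtain ⟨P, hP⟩ := hp.exists_upper_bound
  obtain ⟨G, hG, hcut⟩ := exists_cutoff n
  have hM0 : 0 ≤ M := (abs_nonneg _).trans (abs_mollify_le 0 hM 0)
  have hal : LocallyIntegrable a := locallyIntegrable_flux hp.one_le hgp ha hb hab
  -- The cutoff power `l + 1` must dominate every value of `p` for the absorption, and `l ≥ 1` makes
  -- `η^l` vanish where `η` does.
  set l : ℕ := ⌈P⌉₊ + 1 with hldef
  have hPl : P ≤ (l : ℝ) + 1 := by
    have := Nat.le_ceil P
    rw [hldef]; push_cast; linarith
  -- The constant is chosen so that `E/R = 2Y`, where `α Y` gathers the factors `|u + M| ≤ 2M`, `l +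
  -- 1`, `|∇η| ≤ G/R` and `b`. The condition `E ≤ R` gives `2Y ≤ 1`, which allows the exponent
  -- `p(x)` to be lowered to `p⁻`.
  refine ⟨2 * (2 * M * (l + 1) * G * b / α), by positivity, fun R hR hER => ?_⟩
  obtain ⟨η, hη, hη0, hη1, hηR, hη2R, hηG⟩ := hcut R hR
  set Y := 2 * M * (l + 1) * G * b / α / R with hYdef
  have hY : 0 ≤ Y := by positivity
  have hEY : 2 * (2 * M * (l + 1) * G * b / α) / R = 2 * Y := by rw [hYdef]; ring
  have hY1 : 2 * Y ≤ 1 := by rw [← hEY, div_le_one hR]; exact hER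
  rw [hEY]
  set B := closedBall (0 : Rn n) (2 * R) with hBdef
  have hBm : MeasurableSet B := isClosed_closedBall.measurableSet
  have hBc : IsCompact B := isCompact_closedBall _ _
  set J : Rn n → ℝ := B.indicator fun _ => 1 with hJdef
  have hJ : Integrable J :=
    (integrable_indicator_iff hBm).2 (integrableOn_const hBc.measure_lt_top.ne)
  have hJint : ∫ x, J x = (volume : Measure (Rn n)).real B := by
    rw [hJdef, integral_indicator hBm]; simp
  have hζ := hη.pow_succ l
  obtain ⟨hi1, hle⟩ := integral_inner_mul_le hp hu hgp ha hb hab hM hweak hζ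
    fun x => pow_nonneg (hη0 x) _
  have hi2 : Integrable fun x => (u x + M) * fderiv ℝ (fun x => η x ^ (l + 1)) x (a x) := by
    refine integrable_mul_fderiv_apply hζ hal (C := 2 * M)
      (hu.1.aestronglyMeasurable.add aestronglyMeasurable_const) ?_
    filter_upwards [hM] with x hx
    have := abs_le.1 hx
    rw [abs_le]; constructor <;> linarith
  have hi3 : Integrable fun x => ‖g x‖ ^ p x * η x ^ (l + 1) := by
    have := hgp.integrable_smul_right_of_hasCompactSupport hζ.continuous hζ.2
    exact this
  -- The bracketed sum has nonpositive integral by the tested inequality, so integrating leaves only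
  -- the `J` term on the right.
  have hpt : ∀ᵐ x, α / 2 * (‖g x‖ ^ p x * η x ^ (l + 1)) ≤ α * (2 * Y) ^ exponentInf p * J x +
      (η x ^ (l + 1) * inner ℝ (g x) (a x)
        + (u x + M) * fderiv ℝ (fun x => η x ^ (l + 1)) x (a x)) := by
    filter_upwards [hM] with x hx
    have hd : DifferentiableAt ℝ η x := hη.1.differentiable (by simp) x
    have hfd : fderiv ℝ (fun x => η x ^ (l + 1)) x (a x)
        = (l + 1) * η x ^ l * fderiv ℝ η x (a x) := by
      rw [(hd.hasFDerivAt.pow (l + 1)).fderiv]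
      simp
    have hl0 : l ≠ 0 := by omega
    rw [hfd]
    by_cases hxB : x ∈ B
    · have hJx : J x = 1 := Set.indicator_of_mem hxB _
      have h1 : α * (‖g x‖ ^ p x * η x ^ (l + 1)) ≤ η x ^ (l + 1) * inner ℝ (g x) (a x) := by
        calc _ = η x ^ (l + 1) * (α * ‖g x‖ ^ p x) := by ring
          _ ≤ _ := mul_le_mul_of_nonneg_left (haα x) (pow_nonneg (hη0 x) _)
      have h2 : |(u x + M) * ((l + 1) * η x ^ l * fderiv ℝ η x (a x))|
          ≤ α * (‖g x‖ ^ (p x - 1) * η x ^ l * Y) := by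
        have hu2 : |u x + M| ≤ 2 * M := by
          have := abs_le.1 hx
          rw [abs_le]; constructor <;> linarith
        have h3 : |fderiv ℝ η x (a x)| ≤ G / R * (b * ‖g x‖ ^ (p x - 1)) :=
          ((fderiv ℝ η x).le_opNorm _).trans
            (mul_le_mul (hηG x) (hab x) (norm_nonneg _) (by positivity))
        have h4 : 0 ≤ (l + 1) * η x ^ l := mul_nonneg (by positivity) (pow_nonneg (hη0 x) _)
        rw [abs_mul, abs_mul, abs_of_nonneg h4]
        calc _ ≤ 2 * M * ((l + 1) * η x ^ l * (G / R * (b * ‖g x‖ ^ (p x - 1)))) := by gcongr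
          _ = _ := by rw [hYdef]; field_simp
      have h5 := rpow_sub_one_mul_pow_mul_le (norm_nonneg (g x)) hY (hη0 x) (hη1 x) (hp.one_le x)
        (by omega : 1 ≤ l) ((hP x).trans hPl)
      have h6 : (2 * Y) ^ p x ≤ (2 * Y) ^ exponentInf p := by
        rcases (by positivity : 0 ≤ 2 * Y).eq_or_lt with h | h
        · rw [← h, Real.zero_rpow (by linarith [hp.one_le x]),
            Real.zero_rpow (by linarith [hp.one_lt_inf])]
        · exact Real.rpow_le_rpow_of_exponent_ge h hY1 (hp.exponentInf_le x)
      have h7 := mul_le_mul_of_nonneg_left (h5.trans (add_le_add_right h6 _)) hα.le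
      have h8 := neg_le_of_abs_le h2
      rw [hJx]
      linarith
    · have hJx : J x = 0 := Set.indicator_of_notMem hxB _
      rw [hJx, hη2R x hxB, zero_pow hl0]
      simp
  have hiJ : Integrable fun x => α * (2 * Y) ^ exponentInf p * J x := hJ.const_mul _
  have hi12 : Integrable fun x => η x ^ (l + 1) * inner ℝ (g x) (a x)
        + (u x + M) * fderiv ℝ (fun x => η x ^ (l + 1)) x (a x) := hi1.add hi2
  have hint := integral_mono_ae (hi3.const_mul (α / 2)) (hiJ.add hi12) hpt
  simp only [Pi.add_apply] at hint
  rw [integral_const_mul, integral_add hiJ hi12, integral_const_mul, integral_add hi1 hi2,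
    hJint] at hint
  have hfin : α * (∫ x, ‖g x‖ ^ p x * η x ^ (l + 1))
      ≤ α * (2 * ((2 * Y) ^ exponentInf p * (volume : Measure (Rn n)).real B)) := by linarith
  refine le_trans ?_ (le_of_mul_le_mul_left hfin hα)
  have hnn : ∀ x, 0 ≤ ‖g x‖ ^ p x * η x ^ (l + 1) := fun x =>
    mul_nonneg (Real.rpow_nonneg (norm_nonneg _) _) (pow_nonneg (hη0 x) _)
  calc ∫ x in closedBall (0 : Rn n) R, ‖g x‖ ^ p x
      = ∫ x in closedBall (0 : Rn n) R, ‖g x‖ ^ p x * η x ^ (l + 1) := by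
        refine setIntegral_congr_fun isClosed_closedBall.measurableSet fun x hx => ?_
        simp [hηR x hx]
    _ ≤ _ := setIntegral_le_integral hi3 (.of_forall hnn)

/-- A bounded subsolution whose exponent satisfies `p⁻ > n` has vanishing gradient. -/
theorem ae_gradient_eq_zero (hp : IsLogHolderExponent p) (hpn : (n : ℝ) < exponentInf p)
    (hu : IsWeakGradient u g)
    (hgp : LocallyIntegrable fun x => ‖g x‖ ^ p x) (ha : AEStronglyMeasurable a) (hα : 0 < α)
    (hb : 0 ≤ b) (hab : ∀ x, ‖a x‖ ≤ b * ‖g x‖ ^ (p x - 1))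
    (haα : ∀ x, α * ‖g x‖ ^ p x ≤ inner ℝ (g x) (a x)) (hM : ∀ᵐ x, |u x| ≤ M)
    (hweak : ∀ φ : Rn n → ℝ, IsTestFunction φ → (∀ x, 0 ≤ φ x) →
      ∫ x, fderiv ℝ φ x (a x) ≤ 0) : ∀ᵐ x, g x = 0 := by
  obtain ⟨E, hE, hcac⟩ := exists_setIntegral_norm_rpow_le hp hu hgp ha hα hb hab haα hM hweak
  set V := (volume : Measure (Rn n)).real (ball 0 1)
  have hlim : Tendsto (fun R : ℝ => 2 * (E ^ exponentInf p * 2 ^ n * V)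
      * R ^ (-(exponentInf p - n))) atTop (𝓝 0) := by
    simpa using (tendsto_rpow_neg_atTop (sub_pos.2 hpn)).const_mul
      (2 * (E ^ exponentInf p * 2 ^ n * V))
  -- Enlarge the ball from `r` to `R` and let `R → ∞`: the right-hand side decays like `R^(n - p⁻)`.
  have hzero : ∀ r : ℝ, ∫ x in closedBall (0 : Rn n) r, ‖g x‖ ^ p x ≤ 0 := by
    intro r
    refine ge_of_tendsto hlim ?_
    filter_upwards [eventually_gt_atTop 0, eventually_ge_atTop E, eventually_ge_atTop r]
      with R hR hER hrR
    calc ∫ x in closedBall (0 : Rn n) r, ‖g x‖ ^ p x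
        ≤ ∫ x in closedBall (0 : Rn n) R, ‖g x‖ ^ p x :=
          setIntegral_mono_set (hgp.integrableOn_isCompact (isCompact_closedBall _ _))
            (.of_forall fun x => Real.rpow_nonneg (norm_nonneg _) _)
            (closedBall_subset_closedBall hrR).eventuallyLE
      _ ≤ _ := hcac R hR hER
      _ = _ := by
        rw [Measure.addHaar_real_closedBall volume _ (by positivity), finrank_euclideanSpace_fin,
          Real.div_rpow hE hR.le, neg_sub, Real.rpow_sub hR, Real.rpow_natCast, mul_pow]
        ring
  have hball : ∀ N : ℕ, ∀ᵐ x, x ∈ closedBall (0 : Rn n) N → g x = 0 := by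
    intro N
    have hnn : ∀ x, 0 ≤ ‖g x‖ ^ p x := fun x => Real.rpow_nonneg (norm_nonneg _) _
    have h1 := le_antisymm (hzero N) (integral_nonneg hnn)
    rw [integral_eq_zero_iff_of_nonneg hnn
      (hgp.integrableOn_isCompact (isCompact_closedBall _ _))] at h1
    rw [← ae_restrict_iff' isClosed_closedBall.measurableSet]
    filter_upwards [h1] with x hx
    exact norm_eq_zero.1
      ((Real.rpow_eq_zero (norm_nonneg _) (by linarith [hp.one_le x])).1 hx)
  filter_upwards [ae_all_iff.2 hball] with x hx
  obtain ⟨N, hN⟩ := exists_nat_ge ‖x‖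
  exact hx N (mem_closedBall_zero_iff.2 hN)

/-- Each mollification is smooth with zero derivative, hence constant, and the mollifications
converge to `u` almost everywhere. -/
theorem IsWeakGradient.ae_eq_const (hu : IsWeakGradient u g) (hg : ∀ᵐ x, g x = 0) :
    ∃ k : ℝ, ∀ᵐ x, u x = k := by
  have hmol : ∀ k x, mollify k g x = 0 := fun k x => by
    rw [mollify_apply]
    refine integral_eq_zero_of_ae ?_
    filter_upwards [ae_comp_sub_left hg x] with t ht
    simp [ht]
  have hconst : ∀ k x y, mollify k u x = mollify k u y := fun k =>
    is_const_of_fderiv_eq_zero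
      ((contDiff_mollify k hu.1 (m := 1)).differentiable one_ne_zero) fun x => by
        ext v
        simp [fderiv_mollify_apply k hu, hmol]
  have hlim := ae_tendsto_mollify hu.1
  obtain ⟨x₀, hx₀⟩ := hlim.exists
  refine ⟨u x₀, ?_⟩
  filter_upwards [hlim] with x hx
  exact tendsto_nhds_unique (hx.congr fun k => hconst k x x₀) hx₀

end

theorem mainTheorem8 (n : ℕ) (p q : Rn n → ℝ)
    (hp : IsLogHolderExponent p) (hpn : (n : ℝ) < exponentInf p)
    (hq : IsVariableExponent q)
    (A : Rn n → ℝ → Rn n → Rn n) (hA : HasVarGrowth p A)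
    (f : ℝ≥0 → ℝ) (hf : Continuous f)
    (u : Rn n → ℝ) (gradU : Rn n → Rn n) (hu : IsSobolevLoc p u gradU)
    (hbdd : ∃ M : ℝ, ∀ᵐ x, |u x| ≤ M)
    (c d : Rn n → ℝ) (hfcd : RiccatiBounds p q c d f gradU)
    (hsup : IsWeakRiccatiSupersolution A f u gradU) :
    ∃ k : ℝ, ∀ᵐ x, u x = k := by
  obtain ⟨M, hM⟩ := hbdd
  obtain ⟨P, hP⟩ := hp.exists_upper_bound
  obtain ⟨α, β, aMin, bMax, -, -, haMin, hα, hαβ, hβ, hcoer, hgrow⟩ := hA.growth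
  obtain ⟨-, -, ⟨cMin, cMax, dMin, dMax, hcMin, -, hcd⟩, hfc⟩ := hfcd
  have hgp : LocallyIntegrable fun x => ‖gradU x‖ ^ p x :=
    locallyIntegrable_iff.2 fun K hK =>
      (hu.gradient_memVarLpLoc K hK).integrableOn_norm_rpow hp.continuous hp.one_le hP
  -- The Riccati term has a sign along `∇u`, which reduces the inequality to `div A ≥ 0`.
  have hf0 : ∀ᵐ x, 0 ≤ f ‖gradU x‖₊ := by
    filter_upwards [hfc] with x hx
    exact (mul_nonneg (hcMin.le.trans (hcd x).1) (Real.rpow_nonneg (norm_nonneg _) _)).trans hx.1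
  refine hu.weakGradient.ae_eq_const (ae_gradient_eq_zero
    (a := fun x => A x (u x) (gradU x)) (α := aMin) (b := bMax) hp hpn hu.weakGradient hgp
    (hA.toIsCaratheodory.aestronglyMeasurable_comp hu.weakGradient.1.aestronglyMeasurable
      hu.weakGradient.2.1.aestronglyMeasurable) haMin
    (haMin.le.trans ((hα 0).trans ((hαβ 0).trans (hβ 0))))
    (fun x => (hgrow x _ _).trans
      (mul_le_mul_of_nonneg_right (hβ x) (Real.rpow_nonneg (norm_nonneg _) _)))
    (fun x => ?_) hM fun φ hφ hφ0 => ?_)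
  · rw [real_inner_comm]
    exact (mul_le_mul_of_nonneg_right (hα x) (Real.rpow_nonneg (norm_nonneg _) _)).trans
      (hcoer x _ _)
  · have h1 := hsup φ hφ hφ0
    -- If the integrand were not integrable, its integral would be 0 by convention, so the sign
    -- holds in every case.
    have h2 : 0 ≤ ∫ x, f ‖gradU x‖₊ * φ x := integral_nonneg_of_ae <| by
      filter_upwards [hf0] with x hx
      exact mul_nonneg hx (hφ0 x)
    have h3 : ∀ x, inner ℝ (A x (u x) (gradU x)) (gradient φ x)
        = fderiv ℝ φ x (A x (u x) (gradU x)) := fun x => by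
      rw [real_inner_comm, inner_gradient_eq]
    simp only [h3] at h1
    linarith
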